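/- **Proposition (Conditional restarting at $x_k$).** Let $F=f+\psi$ on $\mathbb{R}^n$, where $f:\mathbb{R}^n\to\mathbb{R}$ is convex and differentiable and $\psi(x)=\sum_{i=1}^n\psi^i(x^i)$ with each $\psi^i:\mathbb{R}\to\mathbb{R}\cup\{+\infty\}$ closed and convex. Let $v\in\mathbb{R}^n$ have positive entries, put $\|x\|_v^2=\sum_i v_i(x^i)^2$, let $x_*$ be a minimizer of $F$, $F_*=F(x_*)$, and let $\mu_F=\mu_F(v)>0$ satisfy $F(x)\ge F_*+\frac{\mu_F}{2}\|x-x_*\|_v^2$ for all $x\in\mathbb{R}^n$. Given $\theta_0\in(0,1]$, let $\theta_{k+1}=\frac12\big(\sqrt{\theta_k^4+4\theta_k^2}-\theta_k^2\big)$ for $k\ge0$. Start from a (deterministic) point $x_0$ with $\psi(x_0)<+\infty$, and let $(x_k)_{k\ge0}$ be generated by one of the following two algorithms, in both of which $z_0=x_0$ and $y_k=(1-\theta_k)x_k+\theta_kz_k$. *FISTA* ($\theta_0=1$), under the assumption $f(x+h)\le f(x)+\langle\nabla f(x),h\rangle+\frac12\|h\|_v^2$ for all $x,h\in\mathbb{R}^n$: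 $$x_{k+1}=\arg\min_{x\in\mathbb{R}^n}\big\{\langle\nabla f(y_k),x-y_k\rangle+\tfrac12\|x-y_k\|_v^2+\psi(x)\big\},\qquad z_{k+1}=z_k+\tfrac1{\theta_k}(x_{k+1}-y_k).$$ *APPROX* ($\theta_0=\tau/n$), where $\hat S$ is a random subset of $\{1,\dots,n\}$ with $\mathbf P(i\in\hat S)=\mathbf P(j\in\hat S)$ for all $i,j$ and $\tau=\mathbf E|\hat S|>0$, under the assumption $\mathbf E[f(x+h_{[\hat S]})]\le f(x)+\frac{\tau}{n}\big(\langle\nabla f(x),h\rangle+\frac12\|h\|_v^2\big)$ for all $x,h\in\mathbb{R}^n$, where $h_{[S]}=\sum_{i\in S}h^ie_i$: with independent random sets $S_0,S_1,\dots$ distributed as $\hat S$, $$z_{k+1}^i=\arg\min_{z\in\mathbb{R}}\Big\{\nabla_if(y_k)(z-y_k^i)+\frac{\theta_knv_i}{2\tau}|z-z_k^i|^2+\psi^i(z)\Big\}\ (i\in S_k),\qquad z_{k+1}^i=z_k^i\ (i\notin S_k),$$ $$x_{k+1}=y_k+\tfrac n\tau\theta_k(z_{k+1}-z_k).$$ Then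 $F(x_k)$ is finite and integrable for every $k\ge0$, and for every $k\ge1$ $$\mathbf{E}[F(x_k)-F_*]\le\theta_{k-1}^2\left(\frac{1-\theta_0}{\theta_0^2}+\frac{1}{\mu_F\,\theta_0^2}\right)(F(x_0)-F_*)$$ (for FISTA, which is deterministic, $\mathbf E$ is superfluous). Moreover, for every $\alpha\in(0,1)$, if $$k\ge\frac2{\theta_0}\left(\sqrt{\frac{1+\mu_F}{\alpha\mu_F}}-1\right)+1,$$ then $\mathbf{E}[F(x_k)-F_*]\le\alpha\,(F(x_0)-F_*)$. -/

import Mathlib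

open MeasureTheory ProbabilityTheory

noncomputable section

namespace AccGrad

variable {n : ℕ}

/-- Coordinate space `ℝⁿ` with its standard inner product. -/
abbrev Vec (n : ℕ) : Type := EuclideanSpace ℝ (Fin n)

/-- The squared weighted norm `‖x‖_v² = ∑ i, v_i (x^i)²`. -/
def wnormSq (v : Fin n → ℝ) (x : Vec n) : ℝ := ∑ i, v i * (x i) ^ 2

/-- A function `g : ℝ → ℝ ∪ {+∞}` which is closed and convex: its epigraph is a closed convex
subset of the plane. -/
structure ClosedConvex (g : ℝ → EReal) : Prop where
  ne_bot : ∀ t, g t ≠ ⊥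
  convex_epi : Convex ℝ {p : ℝ × ℝ | g p.1 ≤ (p.2 : EReal)}
  closed_epi : IsClosed {p : ℝ × ℝ | g p.1 ≤ (p.2 : EReal)}

/-- The separable function `ψ(x) = ∑ i, ψ^i(x^i)`. -/
def sepSum (ψ : Fin n → ℝ → EReal) (x : Vec n) : EReal := ∑ i, ψ i (x i)

/-- The objective `F = f + ψ`, with values in `ℝ ∪ {+∞}`. -/
def objective (f : Vec n → ℝ) (ψ : Fin n → ℝ → EReal) (x : Vec n) : EReal :=
  (f x : EReal) + sepSum ψ x

/-- The objective gap `F(x) - F(w)` as a real number (meaningful where both values are finite). -/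
def gap (F : Vec n → EReal) (w x : Vec n) : ℝ := (F x).toReal - (F w).toReal

/-- The sequence `θ_{k+1} = (√(θ_k⁴ + 4 θ_k²) - θ_k²) / 2` started at `θ₀`. -/
def theta (θ₀ : ℝ) : ℕ → ℝ
  | 0 => θ₀
  | k + 1 => (Real.sqrt (theta θ₀ k ^ 4 + 4 * theta θ₀ k ^ 2) - theta θ₀ k ^ 2) / 2

/-- `f(x + h) ≤ f(x) + ⟨∇f(x), h⟩ + ½ ‖h‖_v²` for all `x, h`. -/
def QuadUpperBound (f : Vec n → ℝ) (v : Fin n → ℝ) : Prop :=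
  ∀ x h : Vec n, f (x + h) ≤ f x + (inner ℝ (gradient f x) h + 1 / 2 * wnormSq v h)

/-- `(x_k), (y_k), (z_k)` are the sequences produced by FISTA (where `θ₀ = 1`). -/
structure IsFISTA (f : Vec n → ℝ) (ψ : Fin n → ℝ → EReal) (v : Fin n → ℝ)
    (x y z : ℕ → Vec n) : Prop where
  init_mem_dom : sepSum ψ (x 0) ≠ ⊤
  init_z : z 0 = x 0
  y_eq : ∀ k, y k = (1 - theta 1 k) • x k + theta 1 k • z k
  x_argmin : ∀ k, IsMinOn
    (fun u : Vec n =>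
      ((inner ℝ (gradient f (y k)) (u - y k) + 1 / 2 * wnormSq v (u - y k) : ℝ) : EReal)
        + sepSum ψ u) Set.univ (x (k + 1))
  z_eq : ∀ k, z (k + 1) = z k + (1 / theta 1 k) • (x (k + 1) - y k)

/-- `P(i ∈ Ŝ)`, when the random set `Ŝ` has law `q`. -/
def inclProb (q : PMF (Finset (Fin n))) (i : Fin n) : ℝ :=
  ∑ A : Finset (Fin n), if i ∈ A then (q A).toReal else 0

/-- All coordinates have the same probability of belonging to the random set. -/
def IsUniform (q : PMF (Finset (Fin n))) : Prop := ∀ i j, inclProb q i = inclProb q j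

/-- `τ = E|Ŝ|`. -/
def meanCard (q : PMF (Finset (Fin n))) : ℝ :=
  ∑ A : Finset (Fin n), (q A).toReal * (A.card : ℝ)

/-- `h_{[A]}`: keep the coordinates in `A`, set the others to zero. -/
def restrictTo (A : Finset (Fin n)) (h : Vec n) : Vec n :=
  WithLp.toLp 2 (fun i => if i ∈ A then h i else 0)

/-- Expected separable overapproximation `(f, Ŝ) ∼ ESO(v)`:
`E[f(x + h_{[Ŝ]})] ≤ f(x) + (τ/n) (⟨∇f(x), h⟩ + ½ ‖h‖_v²)` for all `x, h`. -/
def ESO (f : Vec n → ℝ) (q : PMF (Finset (Fin n))) (v : Fin n → ℝ) : Prop :=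
  ∀ x h : Vec n,
    ∑ A : Finset (Fin n), (q A).toReal * f (x + restrictTo A h) ≤
      f x + meanCard q / n * (inner ℝ (gradient f x) h + 1 / 2 * wnormSq v h)

/-- `S_0, S_1, …` are independent random subsets of the coordinates, each with law `q`. -/
structure IsIIDSampling {Ω : Type*} [MeasurableSpace Ω] (P : Measure Ω)
    (q : PMF (Finset (Fin n))) (S : ℕ → Ω → Finset (Fin n)) : Prop where
  measurableSet_eq : ∀ k A, MeasurableSet {ω | S k ω = A}
  law : ∀ k A, P {ω | S k ω = A} = q A
  indep : iIndepFun (m := fun _ => (⊤ : MeasurableSpace (Finset (Fin n)))) S P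

/-- `(x_k), (y_k), (z_k)` are the sequences produced by APPROX with parameter `τ` (where
`θ₀ = τ / n`) when `A_k` is the set of coordinates drawn at iteration `k`. -/
structure IsAPPROX (f : Vec n → ℝ) (ψ : Fin n → ℝ → EReal) (v : Fin n → ℝ) (τ : ℝ)
    (A : ℕ → Finset (Fin n)) (x y z : ℕ → Vec n) : Prop where
  init_mem_dom : sepSum ψ (x 0) ≠ ⊤
  init_z : z 0 = x 0
  y_eq : ∀ k, y k = (1 - theta (τ / n) k) • x k + theta (τ / n) k • z k
  z_argmin : ∀ k, ∀ i ∈ A k, IsMinOn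
    (fun t : ℝ =>
      ((gradient f (y k) i * (t - y k i)
          + theta (τ / n) k * n * v i / (2 * τ) * |t - z k i| ^ 2 : ℝ) : EReal)
        + ψ i t) Set.univ (z (k + 1) i)
  z_stay : ∀ k, ∀ i ∉ A k, z (k + 1) i = z k i
  x_eq : ∀ k, x (k + 1) = y k + ((n : ℝ) / τ * theta (τ / n) k) • (z (k + 1) - z k)

end AccGrad

end

noncomputable section

namespace AccGrad

variable {n : ℕ}

/-! ### The step-size sequence -/

/-! Both rates come from the potential `(1 - θ_k) / θ_k² * gap + 1 / (2 θ₀²) * ‖z_k - x_*‖_v²`,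
which never increases (for APPROX, in expectation). Since `θ_{k+1}` is the positive root of `t² = (1
- t) θ_k²`, the factor `1 / θ_k²` left by step `k` is exactly the coefficient at `k + 1`, so the
steps telescope. A single step (`fista_step`, `approx_step`) adds the three-point inequality of the
proximal minimizer, the gradient inequality at `(1 - θ) x + θ x_*`, and the upper model of `f`.
Quadratic growth, used only at `x_0`, trades the initial distance for `2 / μ` times the initial gap
(`rate_of_potential_le`); `1 / θ_k ≥ 1 / θ₀ + k / 2` then gives the iteration count.

APPROX needs two more ideas. The separable formula for an expectation applies to `ψ(z_{k+1})`, not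
to `ψ(x_{k+1})`; but `x_k` is a convex combination of `z_0, …, z_k`, so `surrogate`, the same
combination of the values `ψ(z_j)`, dominates `ψ(x_k)` (`sepReal_le_surrogate`) and has a computable
mean. Moreover, uniqueness of the proximal minimizers makes the iterates functions of the finitely
many sets drawn so far; this yields integrability, and by independence of the next draw the
conditional expectation becomes a finite sum (`integral_le_of_indepFun`). -/

lemma theta_succ_sq (θ₀ : ℝ) (k : ℕ) :
    theta θ₀ (k + 1) ^ 2 = (1 - theta θ₀ (k + 1)) * theta θ₀ k ^ 2 := by
  have h := Real.sq_sqrt (show 0 ≤ theta θ₀ k ^ 4 + 4 * theta θ₀ k ^ 2 by positivity)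
  simp only [theta]
  linear_combination (1 / 4) * h

lemma theta_pos {θ₀ : ℝ} (h0 : 0 < θ₀) : ∀ k, 0 < theta θ₀ k
  | 0 => h0
  | k + 1 => by
    have ih := theta_pos h0 k
    have h : theta θ₀ k ^ 2 < Real.sqrt (theta θ₀ k ^ 4 + 4 * theta θ₀ k ^ 2) := by
      apply Real.lt_sqrt_of_sq_lt
      have : 0 < theta θ₀ k ^ 2 := by positivity
      nlinarith
    simp only [theta]
    linarith

lemma theta_succ_lt_one {θ₀ : ℝ} (h0 : 0 < θ₀) (k : ℕ) : theta θ₀ (k + 1) < 1 := by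
  have h := theta_succ_sq θ₀ k
  have h1 : 0 < theta θ₀ (k + 1) ^ 2 := pow_pos (theta_pos h0 _) 2
  rw [h] at h1
  have := pos_of_mul_pos_left h1 (sq_nonneg _)
  linarith

lemma theta_succ_le {θ₀ : ℝ} (h0 : 0 < θ₀) (k : ℕ) : theta θ₀ (k + 1) ≤ theta θ₀ k := by
  have h := theta_succ_sq θ₀ k
  have h1 := theta_pos h0 (k + 1)
  refine (sq_le_sq₀ h1.le (theta_pos h0 k).le).1 ?_
  rw [h]
  nlinarith [sq_nonneg (theta θ₀ k)]

lemma theta_le_init {θ₀ : ℝ} (h0 : 0 < θ₀) : ∀ k, theta θ₀ k ≤ θ₀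
  | 0 => le_rfl
  | k + 1 => (theta_succ_le h0 k).trans (theta_le_init h0 k)

/-- After squaring this is `(1 - θ₀)² ≤ 1 - θ₀ ≤ 1 - θ_{k+1}`. It keeps the weights of the `z_j` in
`x_k` nonnegative. -/
lemma one_sub_mul_theta_le_succ {θ₀ : ℝ} (h0 : 0 < θ₀) (h1 : θ₀ ≤ 1) (k : ℕ) :
    (1 - θ₀) * theta θ₀ k ≤ theta θ₀ (k + 1) := by
  refine (sq_le_sq₀ (mul_nonneg (by linarith) (theta_pos h0 k).le) (theta_pos h0 _).le).1 ?_
  rw [theta_succ_sq, mul_pow]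
  have h2 := theta_le_init h0 (k + 1)
  have h3 : (1 - θ₀) ^ 2 ≤ 1 - theta θ₀ (k + 1) := by nlinarith
  exact mul_le_mul_of_nonneg_right h3 (sq_nonneg _)

lemma one_sub_theta_succ_div_sq {θ₀ : ℝ} (h0 : 0 < θ₀) (k : ℕ) :
    (1 - theta θ₀ (k + 1)) / theta θ₀ (k + 1) ^ 2 = 1 / theta θ₀ k ^ 2 := by
  have h1 := theta_pos h0 k
  have h2 := theta_pos h0 (k + 1)
  rw [div_eq_div_iff (by positivity) (by positivity)]
  linarith [theta_succ_sq θ₀ k]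

lemma le_one_div_theta {θ₀ : ℝ} (h0 : 0 < θ₀) : ∀ k : ℕ, 1 / θ₀ + k / 2 ≤ 1 / theta θ₀ k
  | 0 => by simp [theta]
  | k + 1 => by
    have ih := le_one_div_theta h0 k
    have h1 := theta_pos h0 k
    have h2 := theta_pos h0 (k + 1)
    have h3 := one_sub_theta_succ_div_sq h0 k
    set a := 1 / theta θ₀ k with ha
    set b := 1 / theta θ₀ (k + 1) with hb
    have ha0 : 0 < a := by positivity
    have hb1 : 1 ≤ b := (one_le_div h2).2 (theta_succ_lt_one h0 k).le
    have h4 : b ^ 2 - b = a ^ 2 := by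
      rw [ha, hb, div_pow, one_pow, div_pow, one_pow, ← h3]
      field_simp
    -- Completing the square: `(b - 1/2)² = a² + 1/4`.
    have h5 : a ≤ b - 1 / 2 := by nlinarith
    push_cast
    linarith

/-- Enough iterations turn the `θ²` rate into a contraction by the factor `α`. -/
lemma theta_sq_mul_le {θ₀ μ α : ℝ} (h0 : 0 < θ₀) (hμ : 0 < μ) (hα : 0 < α)
    (hα1 : α < 1) {k : ℕ}
    (hk : 2 / θ₀ * (Real.sqrt ((1 + μ) / (α * μ)) - 1) + 1 ≤ (k : ℝ)) :
    1 ≤ k ∧ theta θ₀ (k - 1) ^ 2 * ((1 - θ₀) / θ₀ ^ 2 + 1 / (μ * θ₀ ^ 2)) ≤ α := by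
  set s := Real.sqrt ((1 + μ) / (α * μ)) with hs
  have hs2 : s ^ 2 = (1 + μ) / (α * μ) := Real.sq_sqrt (by positivity)
  have hs1 : 1 ≤ s := by
    rw [hs, Real.one_le_sqrt, one_le_div (by positivity)]
    nlinarith
  have hk1 : (1 : ℝ) ≤ k := by
    have : 0 ≤ 2 / θ₀ * (s - 1) := mul_nonneg (by positivity) (by linarith)
    linarith
  have hk1' : 1 ≤ k := by exact_mod_cast hk1
  refine ⟨hk1', ?_⟩
  have h1 := le_one_div_theta h0 (k - 1)
  have ht := theta_pos h0 (k - 1)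
  rw [Nat.cast_sub hk1', Nat.cast_one] at h1
  have h2 : s / θ₀ ≤ 1 / theta θ₀ (k - 1) := by
    have : s / θ₀ = (2 / θ₀ * (s - 1)) / 2 + 1 / θ₀ := by field_simp; ring
    linarith
  set t := theta θ₀ (k - 1)
  have h3 : s * t ≤ θ₀ := by
    rw [div_le_div_iff₀ h0 ht] at h2
    linarith
  have h4 : s ^ 2 * t ^ 2 ≤ θ₀ ^ 2 := by
    rw [← mul_pow]
    exact pow_le_pow_left₀ (by positivity) h3 2
  rw [hs2] at h4
  have h5 : (1 - θ₀) / θ₀ ^ 2 + 1 / (μ * θ₀ ^ 2) = ((1 + μ) - θ₀ * μ) / (μ * θ₀ ^ 2) := by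
    field_simp
    ring
  have h6 : (1 + μ) * t ^ 2 ≤ α * μ * θ₀ ^ 2 := by
    have h := mul_le_mul_of_nonneg_left h4 (show 0 ≤ α * μ by positivity)
    have e : α * μ * ((1 + μ) / (α * μ) * t ^ 2) = (1 + μ) * t ^ 2 := by field_simp
    linarith
  rw [h5, mul_div_assoc', div_le_iff₀ (by positivity)]
  nlinarith [mul_pos (mul_pos h0 hμ) (pow_pos ht 2)]

/-! ### Real-valued versions of the extended-valued functions -/

/-- Convexity of the epigraph, applied to the graph points over `x` and `y`, gives both convexity of
the domain and the inequality, so the remaining analysis can use real values. -/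
lemma ClosedConvex.convexOn_toReal {g : ℝ → EReal} (hg : ClosedConvex g) :
    ConvexOn ℝ {t | g t ≠ ⊤} (fun t => (g t).toReal) := by
  have key : ∀ ⦃x⦄, g x ≠ ⊤ → ∀ ⦃y⦄, g y ≠ ⊤ → ∀ ⦃a b : ℝ⦄, 0 ≤ a → 0 ≤ b → a + b = 1 →
      g (a * x + b * y) ≤ ((a * (g x).toReal + b * (g y).toReal : ℝ) : EReal) := by
    intro x hx y hy a b ha hb hab
    have h1 : ((x, (g x).toReal) : ℝ × ℝ) ∈ {p : ℝ × ℝ | g p.1 ≤ (p.2 : EReal)} :=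
      (EReal.coe_toReal hx (hg.ne_bot x)).ge
    have h2 : ((y, (g y).toReal) : ℝ × ℝ) ∈ {p : ℝ × ℝ | g p.1 ≤ (p.2 : EReal)} :=
      (EReal.coe_toReal hy (hg.ne_bot y)).ge
    exact hg.convex_epi h1 h2 ha hb hab
  refine ⟨fun x hx y hy a b ha hb hab => ?_, fun x hx y hy a b ha hb hab => ?_⟩
  · exact ((key hx hy ha hb hab).trans_lt (EReal.coe_lt_top _)).ne
  · have h := key hx hy ha hb hab
    have h' : g (a * x + b * y) ≠ ⊤ := (h.trans_lt (EReal.coe_lt_top _)).ne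
    rw [← EReal.coe_toReal h' (hg.ne_bot _), EReal.coe_le_coe_iff] at h
    exact h

/-- The effective domain of the separable function `ψ`. -/
def sepDom (ψ : Fin n → ℝ → EReal) : Set (Vec n) := {x | ∀ i, ψ i (x i) ≠ ⊤}

/-- The real value of the separable function `ψ` on its effective domain. -/
def sepReal (ψ : Fin n → ℝ → EReal) (x : Vec n) : ℝ := ∑ i, (ψ i (x i)).toReal

lemma sepSum_eq_coe {ψ : Fin n → ℝ → EReal} (hψ : ∀ i, ClosedConvex (ψ i)) {x : Vec n}
    (hx : x ∈ sepDom ψ) : sepSum ψ x = (sepReal ψ x : EReal) := by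
  have : ∀ s : Finset (Fin n),
      ∑ i ∈ s, ψ i (x i) = ((∑ i ∈ s, (ψ i (x i)).toReal : ℝ) : EReal) := by
    intro s
    induction s using Finset.cons_induction with
    | empty => simp
    | cons a s ha ih =>
      rw [Finset.sum_cons, Finset.sum_cons, ih, EReal.coe_add,
        EReal.coe_toReal (hx a) ((hψ a).ne_bot _)]
  exact this Finset.univ

lemma mem_sepDom_iff {ψ : Fin n → ℝ → EReal} (hψ : ∀ i, ClosedConvex (ψ i)) {x : Vec n} :
    x ∈ sepDom ψ ↔ sepSum ψ x ≠ ⊤ := by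
  refine ⟨fun h => by rw [sepSum_eq_coe hψ h]; exact EReal.coe_ne_top _, fun h i hi => h ?_⟩
  have hb : ∀ s : Finset (Fin n), ∑ j ∈ s, ψ j (x j) ≠ ⊥ := by
    intro s
    induction s using Finset.cons_induction with
    | empty => simp
    | cons a s ha ih =>
      rw [Finset.sum_cons]
      exact EReal.add_ne_bot_iff.2 ⟨(hψ a).ne_bot _, ih⟩
  rw [sepSum, ← Finset.add_sum_erase _ _ (Finset.mem_univ i), hi]
  exact EReal.top_add_of_ne_bot (hb _)

lemma convexOn_sepReal {ψ : Fin n → ℝ → EReal} (hψ : ∀ i, ClosedConvex (ψ i)) :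
    ConvexOn ℝ (sepDom ψ) (sepReal ψ) := by
  refine ⟨fun x hx y hy a b ha hb hab i => ?_, fun x hx y hy a b ha hb hab => ?_⟩
  · exact (hψ i).convexOn_toReal.1 (hx i) (hy i) ha hb hab
  · simp only [sepReal, smul_eq_mul, Finset.mul_sum, ← Finset.sum_add_distrib]
    exact Finset.sum_le_sum fun i _ => (hψ i).convexOn_toReal.2 (hx i) (hy i) ha hb hab

lemma objective_eq_coe {f : Vec n → ℝ} {ψ : Fin n → ℝ → EReal}
    (hψ : ∀ i, ClosedConvex (ψ i)) {x : Vec n} (hx : x ∈ sepDom ψ) :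
    objective f ψ x = ((f x + sepReal ψ x : ℝ) : EReal) := by
  rw [objective, sepSum_eq_coe hψ hx, EReal.coe_add]

lemma mem_sepDom_of_objective_ne_top {f : Vec n → ℝ} {ψ : Fin n → ℝ → EReal}
    (hψ : ∀ i, ClosedConvex (ψ i)) {x : Vec n} (hx : objective f ψ x ≠ ⊤) : x ∈ sepDom ψ := by
  rw [mem_sepDom_iff hψ]
  rintro h
  exact hx (by rw [objective, h, EReal.coe_add_top])

lemma gap_eq {f : Vec n → ℝ} {ψ : Fin n → ℝ → EReal} (hψ : ∀ i, ClosedConvex (ψ i))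
    {w x : Vec n} (hw : w ∈ sepDom ψ) (hx : x ∈ sepDom ψ) :
    gap (objective f ψ) w x = f x + sepReal ψ x - (f w + sepReal ψ w) := by
  rw [gap, objective_eq_coe hψ hw, objective_eq_coe hψ hx, EReal.toReal_coe, EReal.toReal_coe]

lemma inner_eq_sum (g h : Vec n) : inner ℝ g h = ∑ i, g i * h i := by
  simp [PiLp.inner_apply, mul_comm]

lemma wnormSq_nonneg {v : Fin n → ℝ} (hv : ∀ i, 0 < v i) (x : Vec n) : 0 ≤ wnormSq v x :=
  Finset.sum_nonneg fun i _ => mul_nonneg (hv i).le (sq_nonneg _)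

/-! ### Convexity inequalities -/

lemma gradient_inequality {f : Vec n → ℝ} (hd : Differentiable ℝ f)
    (hc : ConvexOn ℝ Set.univ f) (y x : Vec n) :
    f y + inner ℝ (gradient f y) (x - y) ≤ f x := by
  have hline : ConvexOn ℝ Set.univ (fun s : ℝ => f (AffineMap.lineMap y x s)) := by
    exact hc.comp_affineMap (AffineMap.lineMap y x : ℝ →ᵃ[ℝ] Vec n)
  have hder : HasDerivAt (fun s : ℝ => f (AffineMap.lineMap y x s))
      (inner ℝ (gradient f y) (x - y)) 0 := by
    have h1 : HasDerivAt (fun s : ℝ => (AffineMap.lineMap y x s : Vec n)) (x - y) 0 :=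
      AffineMap.hasDerivAt_lineMap
    have h2 := ((hd y).hasGradientAt).hasFDerivAt
    rw [← AffineMap.lineMap_apply_zero (k := ℝ) y x] at h2
    have h3 := h2.comp_hasDerivAt (0 : ℝ) h1
    rw [AffineMap.lineMap_apply_zero] at h3
    exact h3
  have := hline.le_slope_of_hasDerivAt (Set.mem_univ 0) (Set.mem_univ 1) one_pos hder
  simp only [slope_def_field, AffineMap.lineMap_apply_zero, AffineMap.lineMap_apply_one] at this
  linarith

/-- Strong convexity of a convex function of one variable plus a quadratic one. -/
lemma quad_add_convex_le {D : Set ℝ} {g : ℝ → ℝ} (hg : ConvexOn ℝ D g) (a c y z : ℝ)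
    {w u : ℝ} (hw : w ∈ D) (hu : u ∈ D) {s : ℝ} (hs : 0 ≤ s) (hs1 : s ≤ 1) :
    a * ((1 - s) * w + s * u - y) + c * ((1 - s) * w + s * u - z) ^ 2 + g ((1 - s) * w + s * u) ≤
      (1 - s) * (a * (w - y) + c * (w - z) ^ 2 + g w)
        + s * (a * (u - y) + c * (u - z) ^ 2 + g u) - s * (1 - s) * (c * (u - w) ^ 2) := by
  have h := hg.2 hw hu (sub_nonneg.2 hs1) hs (by ring)
  simp only [smul_eq_mul] at h
  linear_combination h

/-- Dividing by `s` gives `(1 - s) Q ≤ b - a`, and `s → 0` concludes. With `a` the minimal value and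
`b` the value at a competitor, this is quadratic growth at a minimizer. -/
lemma add_le_of_forall_le_segment {a b Q : ℝ}
    (h : ∀ s : ℝ, 0 < s → s < 1 → a ≤ (1 - s) * a + s * b - s * (1 - s) * Q) : a + Q ≤ b := by
  by_contra! hlt
  have key : ∀ s : ℝ, 0 < s → s < 1 → (1 - s) * Q ≤ b - a := fun s hs hs1 => by
    have := h s hs hs1
    nlinarith
  rcases le_or_gt Q 0 with hQ | hQ
  · have := key (1 / 2) (by norm_num) (by norm_num)
    linarith
  · have hd : 0 ≤ b - a := by
      have := key (1 / 2) (by norm_num) (by norm_num)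
      linarith
    -- This `s` makes `(1 - s) Q` the midpoint of `Q` and `b - a`, which exceeds `b - a`.
    set s := (Q - (b - a)) / (2 * Q) with hs
    have h1 : s * (2 * Q) = Q - (b - a) := by rw [hs]; field_simp
    have h2 : 0 < s := by rw [hs]; apply div_pos <;> linarith
    have h3 : s < 1 := by nlinarith
    have := key s h2 h3
    nlinarith

lemma min_quad_add_le {D : Set ℝ} {g : ℝ → ℝ} (hg : ConvexOn ℝ D g) (a c y z : ℝ)
    {w : ℝ} (hw : w ∈ D)
    (hmin : ∀ t ∈ D, a * (w - y) + c * (w - z) ^ 2 + g w ≤ a * (t - y) + c * (t - z) ^ 2 + g t)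
    {u : ℝ} (hu : u ∈ D) :
    a * (w - y) + c * (w - z) ^ 2 + g w + c * (u - w) ^ 2 ≤
      a * (u - y) + c * (u - z) ^ 2 + g u := by
  refine add_le_of_forall_le_segment fun s hs hs1 => ?_
  refine (hmin _ (hg.1 hw hu (sub_nonneg.2 hs1.le) hs.le (by ring))).trans ?_
  exact quad_add_convex_le hg a c y z hw hu hs.le hs1.le

/-- The scalar proximal step: the minimizer lies in the domain and satisfies the three-point
inequality. -/
lemma ClosedConvex.isMinOn_quad {g : ℝ → EReal} (hg : ClosedConvex g) {a c y z w : ℝ}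
    (hmin : IsMinOn (fun t : ℝ => ((a * (t - y) + c * |t - z| ^ 2 : ℝ) : EReal) + g t)
      Set.univ w) {t₀ : ℝ} (ht₀ : g t₀ ≠ ⊤) :
    g w ≠ ⊤ ∧ ∀ u, g u ≠ ⊤ →
      a * (w - y) + c * (w - z) ^ 2 + (g w).toReal + c * (u - w) ^ 2 ≤
        a * (u - y) + c * (u - z) ^ 2 + (g u).toReal := by
  simp only [sq_abs] at hmin
  have hm : ∀ t, ((a * (w - y) + c * (w - z) ^ 2 : ℝ) : EReal) + g w ≤
      ((a * (t - y) + c * (t - z) ^ 2 : ℝ) : EReal) + g t := fun t => hmin (Set.mem_univ t)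
  have hw : g w ≠ ⊤ := by
    intro hw
    have h := hm t₀
    rw [hw, EReal.coe_add_top, top_le_iff] at h
    exact EReal.add_ne_top (EReal.coe_ne_top _) ht₀ h
  refine ⟨hw, fun u hu => ?_⟩
  refine min_quad_add_le hg.convexOn_toReal a c y z hw (fun t ht => ?_) hu
  have h := hm t
  rw [← EReal.coe_toReal hw (hg.ne_bot w), ← EReal.coe_toReal ht (hg.ne_bot t),
    ← EReal.coe_add, ← EReal.coe_add, EReal.coe_le_coe_iff] at h
  exact h

lemma ClosedConvex.isMinOn_quad_unique {g : ℝ → EReal} (hg : ClosedConvex g)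
    {a c y z w w' : ℝ} (hc : 0 < c)
    (hw : IsMinOn (fun t : ℝ => ((a * (t - y) + c * |t - z| ^ 2 : ℝ) : EReal) + g t) Set.univ w)
    (hw' : IsMinOn (fun t : ℝ => ((a * (t - y) + c * |t - z| ^ 2 : ℝ) : EReal) + g t)
      Set.univ w') {t₀ : ℝ} (ht₀ : g t₀ ≠ ⊤) : w = w' := by
  obtain ⟨h1, h2⟩ := hg.isMinOn_quad hw ht₀
  obtain ⟨h1', h2'⟩ := hg.isMinOn_quad hw' ht₀
  have h := h2 _ h1'
  have h' := h2' _ h1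
  have : c * (w' - w) ^ 2 ≤ 0 := by nlinarith
  have : (w' - w) ^ 2 = 0 := le_antisymm (by nlinarith) (sq_nonneg _)
  have := pow_eq_zero_iff (two_ne_zero) |>.1 this
  linarith

/-! ### FISTA -/

lemma wnormSq_smul (v : Fin n → ℝ) (c : ℝ) (x : Vec n) :
    wnormSq v (c • x) = c ^ 2 * wnormSq v x := by
  simp only [wnormSq, PiLp.smul_apply, smul_eq_mul, Finset.mul_sum]
  exact Finset.sum_congr rfl fun i _ => by ring

lemma wnormSq_sub_comm (v : Fin n → ℝ) (x y : Vec n) :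
    wnormSq v (x - y) = wnormSq v (y - x) := by
  simp only [wnormSq, PiLp.sub_apply]
  exact Finset.sum_congr rfl fun i _ => by ring

/-- The proximal gradient step: the minimizer lies in the domain and satisfies the three-point
inequality. -/
lemma prox_step {ψ : Fin n → ℝ → EReal} (hψ : ∀ i, ClosedConvex (ψ i)) {v : Fin n → ℝ}
    {g y w u₀ : Vec n}
    (hmin : IsMinOn (fun u : Vec n =>
      ((inner ℝ g (u - y) + 1 / 2 * wnormSq v (u - y) : ℝ) : EReal) + sepSum ψ u) Set.univ w)
    (hu₀ : u₀ ∈ sepDom ψ) :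
    w ∈ sepDom ψ ∧ ∀ u ∈ sepDom ψ,
      inner ℝ g (w - y) + 1 / 2 * wnormSq v (w - y) + sepReal ψ w + 1 / 2 * wnormSq v (u - w) ≤
        inner ℝ g (u - y) + 1 / 2 * wnormSq v (u - y) + sepReal ψ u := by
  have hm : ∀ t, ((inner ℝ g (w - y) + 1 / 2 * wnormSq v (w - y) : ℝ) : EReal) + sepSum ψ w ≤
      ((inner ℝ g (t - y) + 1 / 2 * wnormSq v (t - y) : ℝ) : EReal) + sepSum ψ t :=
    fun t => hmin (Set.mem_univ t)
  have hw : w ∈ sepDom ψ := by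
    rw [mem_sepDom_iff hψ]
    intro hw
    have h := hm u₀
    rw [hw, EReal.coe_add_top, top_le_iff] at h
    exact EReal.add_ne_top (EReal.coe_ne_top _) ((mem_sepDom_iff hψ).1 hu₀) h
  refine ⟨hw, fun u hu => add_le_of_forall_le_segment fun s hs hs1 => ?_⟩
  have hmem := (convexOn_sepReal hψ).1 hw hu (sub_nonneg.2 hs1.le) hs.le (by ring)
  have h := hm ((1 - s) • w + s • u)
  rw [sepSum_eq_coe hψ hw, sepSum_eq_coe hψ hmem, ← EReal.coe_add, ← EReal.coe_add,
    EReal.coe_le_coe_iff] at h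
  refine h.trans ?_
  simp only [inner_eq_sum, wnormSq, sepReal, Finset.mul_sum, ← Finset.sum_add_distrib,
    ← Finset.sum_sub_distrib]
  refine Finset.sum_le_sum fun i _ => ?_
  have := quad_add_convex_le (hψ i).convexOn_toReal (g i) (1 / 2 * v i) (y i) (y i) (hw i) (hu i)
    hs.le hs1.le
  simp only [PiLp.sub_apply, PiLp.add_apply, PiLp.smul_apply, smul_eq_mul]
  linarith

/-- One step of FISTA. -/
lemma fista_step {f : Vec n → ℝ} {ψ : Fin n → ℝ → EReal} {v : Fin n → ℝ}
    (hd : Differentiable ℝ f) (hc : ConvexOn ℝ Set.univ f) (hψ : ∀ i, ClosedConvex (ψ i))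
    (hub : QuadUpperBound f v) {θ : ℝ} (hθ : 0 < θ) (hθ1 : θ ≤ 1) {xs x y z x' z' : Vec n}
    (hxs : xs ∈ sepDom ψ) (hx : x ∈ sepDom ψ) (hy : y = (1 - θ) • x + θ • z)
    (hmin : IsMinOn (fun u : Vec n =>
      ((inner ℝ (gradient f y) (u - y) + 1 / 2 * wnormSq v (u - y) : ℝ) : EReal) + sepSum ψ u)
      Set.univ x')
    (hz : z' = z + (1 / θ) • (x' - y)) :
    x' ∈ sepDom ψ ∧
      f x' + sepReal ψ x' - (f xs + sepReal ψ xs) + θ ^ 2 / 2 * wnormSq v (z' - xs) ≤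
        (1 - θ) * (f x + sepReal ψ x - (f xs + sepReal ψ xs))
          + θ ^ 2 / 2 * wnormSq v (z - xs) := by
  obtain ⟨hx', hp⟩ := prox_step hψ hmin hxs
  refine ⟨hx', ?_⟩
  have hθ1' := sub_nonneg.2 hθ1
  -- The competitor is `(1 - θ) x + θ x_*`: its differences from `y` and from `x'` are `θ (x_* - z)`
  -- and `θ (x_* - z')`, which is where the factor `θ²` on the distances originates.
  have h1 := hp _ ((convexOn_sepReal hψ).1 hx hxs hθ1' hθ.le (by ring))
  have h2 := (convexOn_sepReal hψ).2 hx hxs hθ1' hθ.le (by ring)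
  have h3 := hc.2 (Set.mem_univ x) (Set.mem_univ xs) hθ1' hθ.le (by ring)
  have h4 := gradient_inequality hd hc y ((1 - θ) • x + θ • xs)
  have h5 := hub y (x' - y)
  rw [add_sub_cancel] at h5
  have e1 : (1 - θ) • x + θ • xs - y = θ • (xs - z) := by rw [hy]; module
  have e2 : (1 - θ) • x + θ • xs - x' = θ • (xs - z') := by
    rw [hz, smul_sub θ xs, smul_add, smul_smul, mul_one_div_cancel hθ.ne', one_smul, hy]
    module
  have e3 := wnormSq_smul v θ (xs - z)
  have e4 := wnormSq_smul v θ (xs - z')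
  rw [wnormSq_sub_comm v xs z, ← e1] at e3
  rw [wnormSq_sub_comm v xs z', ← e2] at e4
  simp only [smul_eq_mul] at h2 h3
  nlinarith

lemma div_sq_add_le_of_step {θ a b s t c : ℝ} (hθ : 0 < θ)
    (h : a + c * θ ^ 2 * s ≤ (1 - θ) * b + c * θ ^ 2 * t) :
    1 / θ ^ 2 * a + c * s ≤ (1 - θ) / θ ^ 2 * b + c * t := by
  have h2 : 0 < θ ^ 2 := by positivity
  have e1 : 1 / θ ^ 2 * a + c * s = (a + c * θ ^ 2 * s) / θ ^ 2 := by field_simp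
  have e2 : (1 - θ) / θ ^ 2 * b + c * t = ((1 - θ) * b + c * θ ^ 2 * t) / θ ^ 2 := by field_simp
  rw [e1, e2]
  gcongr

/-- From a bound on the potential function to the convergence rate. -/
lemma rate_of_potential_le {θ₀ t μ G g N : ℝ} (h0 : 0 < θ₀) (ht : 0 < t) (hμ : 0 < μ)
    (hN : μ / 2 * N ≤ g)
    (h : 1 / t ^ 2 * G ≤ (1 - θ₀) / θ₀ ^ 2 * g + 1 / (2 * θ₀ ^ 2) * N) :
    G ≤ t ^ 2 * ((1 - θ₀) / θ₀ ^ 2 + 1 / (μ * θ₀ ^ 2)) * g := by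
  have h1 : 1 / (2 * θ₀ ^ 2) * N ≤ 1 / (μ * θ₀ ^ 2) * g := by
    have e : 1 / (2 * θ₀ ^ 2) * N = 1 / (μ * θ₀ ^ 2) * (μ / 2 * N) := by field_simp
    rw [e]
    gcongr
  have h2 : 1 / t ^ 2 * G ≤ ((1 - θ₀) / θ₀ ^ 2 + 1 / (μ * θ₀ ^ 2)) * g := by linarith
  have h3 := mul_le_mul_of_nonneg_left h2 (sq_nonneg t)
  have e : t ^ 2 * (1 / t ^ 2 * G) = G := by field_simp
  linarith

lemma IsFISTA.rate {f : Vec n → ℝ} {ψ : Fin n → ℝ → EReal} {v : Fin n → ℝ}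
    {x y z : ℕ → Vec n} (h : IsFISTA f ψ v x y z)
    (hd : Differentiable ℝ f) (hc : ConvexOn ℝ Set.univ f) (hψ : ∀ i, ClosedConvex (ψ i))
    (hub : QuadUpperBound f v) (hv : ∀ i, 0 < v i) {xs : Vec n} (hxs : xs ∈ sepDom ψ) :
    (∀ k, x k ∈ sepDom ψ) ∧
      ∀ k, 1 / theta 1 k ^ 2 * (f (x (k + 1)) + sepReal ψ (x (k + 1)) - (f xs + sepReal ψ xs)) ≤
        1 / 2 * wnormSq v (x 0 - xs) := by
  have hdom : ∀ k, x k ∈ sepDom ψ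
    | 0 => (mem_sepDom_iff hψ).2 h.init_mem_dom
    | k + 1 => (prox_step hψ (h.x_argmin k) hxs).1
  have hθ := fun k => theta_pos one_pos k
  have step : ∀ k, 1 / theta 1 k ^ 2 *
        (f (x (k + 1)) + sepReal ψ (x (k + 1)) - (f xs + sepReal ψ xs))
        + 1 / 2 * wnormSq v (z (k + 1) - xs) ≤
      (1 - theta 1 k) / theta 1 k ^ 2 * (f (x k) + sepReal ψ (x k) - (f xs + sepReal ψ xs))
        + 1 / 2 * wnormSq v (z k - xs) := fun k => by
    refine div_sq_add_le_of_step (hθ k) ?_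
    have := (fista_step hd hc hψ hub (hθ k) (theta_le_init one_pos k) hxs (hdom k) (h.y_eq k)
      (h.x_argmin k) (h.z_eq k)).2
    rwa [← one_div_mul_eq_div] at this
  have tele : ∀ k, 1 / theta 1 k ^ 2 *
        (f (x (k + 1)) + sepReal ψ (x (k + 1)) - (f xs + sepReal ψ xs))
        + 1 / 2 * wnormSq v (z (k + 1) - xs) ≤ 1 / 2 * wnormSq v (x 0 - xs) := by
    intro k
    induction k with
    | zero =>
      have := step 0
      -- Since `θ₀ = 1`, the initial gap has coefficient zero and only the distance survives.
      simpa [theta, h.init_z] using this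
    | succ k ih =>
      have := step (k + 1)
      rw [one_sub_theta_succ_div_sq one_pos] at this
      exact this.trans ih
  refine ⟨hdom, fun k => ?_⟩
  have h1 := tele k
  have h2 := wnormSq_nonneg hv (z (k + 1) - xs)
  linarith

/-! ### Uniform samplings -/

lemma sum_toReal_eq_one (q : PMF (Finset (Fin n))) : ∑ A, (q A).toReal = 1 := by
  have h := q.tsum_coe
  rw [tsum_fintype] at h
  rw [← ENNReal.toReal_sum fun A _ => q.apply_ne_top A, h, ENNReal.toReal_one]

lemma sum_inclProb (q : PMF (Finset (Fin n))) : ∑ i, inclProb q i = meanCard q := by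
  simp only [inclProb, meanCard]
  rw [Finset.sum_comm]
  refine Finset.sum_congr rfl fun A _ => ?_
  rw [Finset.sum_ite_mem, Finset.univ_inter, Finset.sum_const, nsmul_eq_mul, mul_comm]

lemma meanCard_le (q : PMF (Finset (Fin n))) : meanCard q ≤ n := by
  calc meanCard q ≤ ∑ A : Finset (Fin n), (q A).toReal * n := by
        refine Finset.sum_le_sum fun A _ => mul_le_mul_of_nonneg_left ?_ ENNReal.toReal_nonneg
        exact_mod_cast (Finset.card_le_univ A).trans_eq (Fintype.card_fin n)
    _ = n := by rw [← Finset.sum_mul, sum_toReal_eq_one, one_mul]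

lemma IsUniform.inclProb_eq {q : PMF (Finset (Fin n))} (hq : IsUniform q) (i : Fin n) :
    inclProb q i = meanCard q / n := by
  have hn : (n : ℝ) ≠ 0 := by exact_mod_cast i.pos.ne'
  rw [← sum_inclProb, Finset.sum_congr rfl fun j _ => hq j i, Finset.sum_const,
    Finset.card_univ, Fintype.card_fin, nsmul_eq_mul, mul_div_cancel_left₀ _ hn]

lemma exists_mem_of_inclProb_pos {q : PMF (Finset (Fin n))} {i : Fin n}
    (h : 0 < inclProb q i) : ∃ A, i ∈ A ∧ q A ≠ 0 := by
  obtain ⟨A, -, hA⟩ := Finset.exists_ne_zero_of_sum_ne_zero h.ne'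
  by_cases hi : i ∈ A
  · refine ⟨A, hi, fun h0 => hA ?_⟩
    simp [h0]
  · simp [hi] at hA

/-- The sum is affine in the indicators of `i ∈ A`, so only the marginal inclusion probabilities
matter, whatever the dependence between coordinates. -/
lemma sum_mul_sum_ite (q : PMF (Finset (Fin n))) {p : ℝ} (hp : ∀ i, inclProb q i = p)
    (a b : Fin n → ℝ) :
    ∑ A, (q A).toReal * ∑ i, (if i ∈ A then a i else b i) =
      p * ∑ i, a i + (1 - p) * ∑ i, b i := by
  have h1 : ∀ A : Finset (Fin n), (q A).toReal * ∑ i, (if i ∈ A then a i else b i) =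
      ∑ i, ((if i ∈ A then (q A).toReal else 0) * (a i - b i) + (q A).toReal * b i) := by
    intro A
    rw [Finset.mul_sum]
    refine Finset.sum_congr rfl fun i _ => ?_
    split_ifs <;> ring
  simp only [h1]
  rw [Finset.sum_comm]
  simp only [Finset.sum_add_distrib, ← Finset.sum_mul, sum_toReal_eq_one]
  have h2 : ∀ i, (∑ A : Finset (Fin n), if i ∈ A then (q A).toReal else 0) = p := hp
  simp only [h2, ← Finset.mul_sum, Finset.sum_sub_distrib]
  ring

/-! ### APPROX -/

/-- One step of APPROX, in expectation over the sampled coordinates; `R` stands for the upper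
bound on `ψ x` carried along by the analysis and `zt` for the full proximal step. -/
lemma approx_step {f : Vec n → ℝ} {ψ : Fin n → ℝ → EReal} {v : Fin n → ℝ}
    (hd : Differentiable ℝ f) (hc : ConvexOn ℝ Set.univ f) {q : PMF (Finset (Fin n))}
    (hq : IsUniform q) (hESO : ESO f q v) {θ₀ θ R : ℝ} (hθ₀ : θ₀ = meanCard q / n)
    (h0 : 0 < θ₀) (hθ : 0 < θ) (hθ1 : θ ≤ 1) {xs x y z zt : Vec n} {zp : Finset (Fin n) → Vec n}
    (hy : y = (1 - θ) • x + θ • z)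
    (hprox : ∀ i, gradient f y i * (zt i - y i) + θ * v i / (2 * θ₀) * (zt i - z i) ^ 2
        + (ψ i (zt i)).toReal + θ * v i / (2 * θ₀) * (xs i - zt i) ^ 2 ≤
      gradient f y i * (xs i - y i) + θ * v i / (2 * θ₀) * (xs i - z i) ^ 2
        + (ψ i (xs i)).toReal)
    (hzp : ∀ A i, zp A i = if i ∈ A then zt i else z i) :
    ∑ A, (q A).toReal * (f (y + (θ / θ₀) • (zp A - z))
        + ((1 - θ) * R - θ * (1 / θ₀ - 1) * sepReal ψ z + θ / θ₀ * sepReal ψ (zp A))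
        - (f xs + sepReal ψ xs) + 1 / (2 * θ₀ ^ 2) * θ ^ 2 * wnormSq v (zp A - xs)) ≤
      (1 - θ) * (f x + R - (f xs + sepReal ψ xs))
        + 1 / (2 * θ₀ ^ 2) * θ ^ 2 * wnormSq v (z - xs) := by
  have hp : ∀ i, inclProb q i = θ₀ := fun i => (hq.inclProb_eq i).trans hθ₀.symm
  -- Writing `θ = ρ θ₀` removes the quotients, so the final combination is linear. In the mean the
  -- `ψ(z)` terms cancel: `-(ρ - θ) + ρ (1 - θ₀) = 0`.
  obtain ⟨ρ, hρ⟩ : ∃ ρ, ρ = θ / θ₀ := ⟨_, rfl⟩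
  have hθρ : θ = ρ * θ₀ := by rw [hρ]; field_simp
  have hE_f : ∑ A, (q A).toReal * f (y + ρ • (zp A - z)) ≤
      f y + θ₀ * (ρ * inner ℝ (gradient f y) (zt - z) + 1 / 2 * (ρ ^ 2 * wnormSq v (zt - z))) := by
    have h := hESO y (ρ • (zt - z))
    rw [← hθ₀, inner_smul_right, wnormSq_smul] at h
    refine le_trans (Finset.sum_congr rfl fun A _ => ?_).le h
    congr 3
    ext i
    simp only [restrictTo, PiLp.smul_apply, PiLp.sub_apply, smul_eq_mul, hzp]
    split_ifs <;> ring
  have hE_s : ∑ A, (q A).toReal * sepReal ψ (zp A) =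
      θ₀ * sepReal ψ zt + (1 - θ₀) * sepReal ψ z := by
    rw [sepReal, sepReal, ← sum_mul_sum_ite q hp]
    refine Finset.sum_congr rfl fun A _ => ?_
    congr 1
    refine Finset.sum_congr rfl fun i _ => ?_
    rw [hzp]
    split_ifs <;> rfl
  have hE_w : ∑ A, (q A).toReal * wnormSq v (zp A - xs) =
      θ₀ * wnormSq v (zt - xs) + (1 - θ₀) * wnormSq v (z - xs) := by
    rw [wnormSq, wnormSq, ← sum_mul_sum_ite q hp]
    refine Finset.sum_congr rfl fun A _ => ?_
    congr 1
    refine Finset.sum_congr rfl fun i _ => ?_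
    rw [PiLp.sub_apply, hzp]
    split_ifs <;> rfl
  have hpr : inner ℝ (gradient f y) (zt - xs) + ρ / 2 * wnormSq v (zt - z) + sepReal ψ zt
      + ρ / 2 * wnormSq v (zt - xs) ≤ sepReal ψ xs + ρ / 2 * wnormSq v (z - xs) := by
    simp only [inner_eq_sum, wnormSq, sepReal, Finset.mul_sum, ← Finset.sum_add_distrib]
    refine Finset.sum_le_sum fun i _ => ?_
    have h := hprox i
    have e : θ * v i / (2 * θ₀) = ρ / 2 * v i := by rw [hρ]; field_simp
    rw [e] at h
    simp only [PiLp.sub_apply]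
    linarith
  have hgr := gradient_inequality hd hc y ((1 - θ) • x + θ • xs)
  have e1 : (1 - θ) • x + θ • xs - y = θ • (xs - z) := by rw [hy]; module
  rw [e1, inner_smul_right] at hgr
  have hcv := hc.2 (Set.mem_univ x) (Set.mem_univ xs) (sub_nonneg.2 hθ1) hθ.le (by ring)
  simp only [smul_eq_mul] at hcv
  have e2 : (inner ℝ (gradient f y) (zt - z) : ℝ) =
      inner ℝ (gradient f y) (zt - xs) + inner ℝ (gradient f y) (xs - z) := by
    rw [← inner_add_right, sub_add_sub_cancel]
  rw [e2] at hE_f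
  have e3 : ∑ A, (q A).toReal * (f (y + ρ • (zp A - z))
        + ((1 - θ) * R - θ * (1 / θ₀ - 1) * sepReal ψ z + ρ * sepReal ψ (zp A))
        - (f xs + sepReal ψ xs) + 1 / (2 * θ₀ ^ 2) * θ ^ 2 * wnormSq v (zp A - xs)) =
      ∑ A, (q A).toReal * f (y + ρ • (zp A - z))
        + ((1 - θ) * R - θ * (1 / θ₀ - 1) * sepReal ψ z - (f xs + sepReal ψ xs))
          * ∑ A, (q A).toReal
        + ρ * ∑ A, (q A).toReal * sepReal ψ (zp A)
        + ρ ^ 2 / 2 * ∑ A, (q A).toReal * wnormSq v (zp A - xs) := by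
    simp only [Finset.mul_sum, ← Finset.sum_add_distrib]
    refine Finset.sum_congr rfl fun A _ => ?_
    rw [hρ]
    field_simp
    ring
  rw [← hρ, e3, hE_s, hE_w, sum_toReal_eq_one, mul_one]
  have e4 : θ * (1 / θ₀ - 1) = ρ - θ := by rw [hρ]; ring
  have e5 : 1 / (2 * θ₀ ^ 2) * θ ^ 2 = ρ ^ 2 / 2 := by rw [hρ]; field_simp
  rw [e4, e5]
  have hpr' := mul_le_mul_of_nonneg_left hpr hθ.le
  have hgr' := hgr.trans hcv
  rw [hθρ] at hpr' hgr' ⊢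
  linarith

/-- The upper bound on `ψ(x_k)` obtained by convexity from the decomposition of `x_k` as a convex
combination of `z_0, …, z_k`. -/
def surrogate (ψ : Fin n → ℝ → EReal) (θ₀ : ℝ) (z : ℕ → Vec n) : ℕ → ℝ
  | 0 => sepReal ψ (z 0)
  | k + 1 => (1 - theta θ₀ k) * surrogate ψ θ₀ z k
      - theta θ₀ k * (1 / θ₀ - 1) * sepReal ψ (z k) + theta θ₀ k / θ₀ * sepReal ψ (z (k + 1))

lemma surrogate_congr {ψ : Fin n → ℝ → EReal} {θ₀ : ℝ} {z z' : ℕ → Vec n} :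
    ∀ {k : ℕ}, (∀ j ≤ k, z j = z' j) → surrogate ψ θ₀ z k = surrogate ψ θ₀ z' k
  | 0, h => by rw [surrogate, surrogate, h 0 le_rfl]
  | k + 1, h => by
    rw [surrogate, surrogate, surrogate_congr fun j hj => h j (hj.trans k.le_succ),
      h k k.le_succ, h (k + 1) le_rfl]

/-- The weight of `z_k` in the decomposition of `x_k`. -/
def lastWeight (θ₀ : ℝ) : ℕ → ℝ
  | 0 => 1
  | k + 1 => theta θ₀ k / θ₀

lemma lastWeight_nonneg {θ₀ : ℝ} (h0 : 0 < θ₀) : ∀ k, 0 ≤ lastWeight θ₀ k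
  | 0 => zero_le_one
  | k + 1 => (div_pos (theta_pos h0 k) h0).le

lemma lastWeight_le_one {θ₀ : ℝ} (h0 : 0 < θ₀) : ∀ k, lastWeight θ₀ k ≤ 1
  | 0 => le_rfl
  | k + 1 => (div_le_one h0).2 (theta_le_init h0 k)

/-- The difference of the two sides is the weight left on `z_k` in `x_{k+1}`, so the decomposition
of `x_{k+1}` stays convex. -/
lemma le_one_sub_theta_mul_lastWeight {θ₀ : ℝ} (h0 : 0 < θ₀) (h1 : θ₀ ≤ 1) :
    ∀ k, theta θ₀ k * (1 / θ₀ - 1) ≤ (1 - theta θ₀ k) * lastWeight θ₀ k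
  | 0 => by
    simp only [theta, lastWeight]
    exact le_of_eq (by field_simp)
  | k + 1 => by
    have hk := theta_pos h0 k
    have hk' := theta_pos h0 (k + 1)
    have e1 := theta_succ_sq θ₀ k
    have e2 := one_sub_mul_theta_le_succ h0 h1 k
    simp only [lastWeight]
    have h3 : theta θ₀ (k + 1) * (1 - θ₀) ≤ (1 - theta θ₀ (k + 1)) * theta θ₀ k := by
      refine le_of_mul_le_mul_right ?_ hk
      nlinarith
    have e4 : theta θ₀ (k + 1) * (1 / θ₀ - 1) = theta θ₀ (k + 1) * (1 - θ₀) / θ₀ := by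
      field_simp
    rw [e4, mul_div_assoc']
    gcongr

namespace IsAPPROX

variable {f : Vec n → ℝ} {ψ : Fin n → ℝ → EReal} {v : Fin n → ℝ} {τ : ℝ}
  {A A' : ℕ → Finset (Fin n)} {x y z x' y' z' : ℕ → Vec n}

lemma mem_sepDom_z (h : IsAPPROX f ψ v τ A x y z) (hψ : ∀ i, ClosedConvex (ψ i)) :
    ∀ k, z k ∈ sepDom ψ
  | 0 => by
    rw [h.init_z]
    exact (mem_sepDom_iff hψ).2 h.init_mem_dom
  | k + 1 => fun i => by
    have ih := mem_sepDom_z h hψ k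
    by_cases hi : i ∈ A k
    · exact ((hψ i).isMinOn_quad (h.z_argmin k i hi) (ih i)).1
    · rw [h.z_stay k i hi]
      exact ih i

/-- `x_k` lies in the domain of `ψ`, and the surrogate dominates `ψ(x_k)`. -/
lemma sepReal_le_surrogate (h : IsAPPROX f ψ v τ A x y z) (hψ : ∀ i, ClosedConvex (ψ i))
    (h0 : 0 < τ / n) (h1 : τ / n ≤ 1) (k : ℕ) :
    x k ∈ sepDom ψ ∧ sepReal ψ (x k) ≤ surrogate ψ (τ / n) z k := by
  have hepi := (convexOn_sepReal hψ).convex_epigraph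
  set E : Set (Vec n × ℝ) := {p | p.1 ∈ sepDom ψ ∧ sepReal ψ p.1 ≤ p.2} with hE
  have hzE : ∀ k, (z k, sepReal ψ (z k)) ∈ E := fun k => ⟨h.mem_sepDom_z hψ k, le_rfl⟩
  -- `x` and the surrogate obey the same linear recursion, so the pair is followed inside the convex
  -- epigraph. Only the weight of the newest `z_k` must be tracked; all older ones are merged into
  -- `m`.
  have key : ∀ k, ∃ m ∈ E, (x k, surrogate ψ (τ / n) z k) =
      (1 - lastWeight (τ / n) k) • m + lastWeight (τ / n) k • (z k, sepReal ψ (z k)) := by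
    intro k
    induction k with
    | zero => exact ⟨_, hzE 0, by simp [lastWeight, surrogate, h.init_z]⟩
    | succ k ih =>
      obtain ⟨m, hm, hxm⟩ := ih
      have hθ1 : theta (τ / n) k ≤ 1 := (theta_le_init h0 k).trans h1
      obtain ⟨m', hm', e⟩ := hepi.exists_mem_add_smul_eq hm (hzE k)
        (mul_nonneg (sub_nonneg.2 hθ1) (sub_nonneg.2 (lastWeight_le_one h0 k)))
        (sub_nonneg.2 (le_one_sub_theta_mul_lastWeight h0 h1 k))
      refine ⟨m', hm', ?_⟩
      have ec : 1 - lastWeight (τ / n) (k + 1) =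
          (1 - theta (τ / n) k) * (1 - lastWeight (τ / n) k)
            + ((1 - theta (τ / n) k) * lastWeight (τ / n) k
              - theta (τ / n) k * (1 / (τ / n) - 1)) := by
        simp only [lastWeight]
        ring
      rw [ec, e]
      have eθ : (n : ℝ) / τ * theta (τ / n) k = theta (τ / n) k * (1 / (τ / n)) := by
        rw [one_div_div, mul_comm]
      have ex : x (k + 1) = (1 - theta (τ / n) k) • x k
          - (theta (τ / n) k * (1 / (τ / n) - 1)) • z k
          + lastWeight (τ / n) (k + 1) • z (k + 1) := by
        rw [h.x_eq, h.y_eq, eθ, lastWeight, div_eq_mul_one_div]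
        module
      rw [Prod.ext_iff] at hxm ⊢
      simp only [Prod.fst_add, Prod.snd_add, Prod.smul_fst, Prod.smul_snd] at hxm ⊢
      refine ⟨?_, ?_⟩
      · rw [ex, hxm.1]
        module
      · rw [surrogate, hxm.2, lastWeight]
        simp only [smul_eq_mul]
        ring
  obtain ⟨m, hm, e⟩ := key k
  have : (x k, surrogate ψ (τ / n) z k) ∈ E := by
    rw [e]
    exact hepi hm (hzE k) (sub_nonneg.2 (lastWeight_le_one h0 k)) (lastWeight_nonneg h0 k)
      (by ring)
  exact this

/-- The coordinate subproblem sees only the current state and is strongly convex, so its minimizer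
does not depend on which other coordinates were sampled. -/
lemma z_succ_congr (h : IsAPPROX f ψ v τ A x y z) (h' : IsAPPROX f ψ v τ A' x' y' z')
    (hψ : ∀ i, ClosedConvex (ψ i)) (hv : ∀ i, 0 < v i) (h0 : 0 < τ / n) {k : ℕ}
    (hx : x k = x' k) (hz : z k = z' k) {i : Fin n} (hi : i ∈ A k) (hi' : i ∈ A' k) :
    z (k + 1) i = z' (k + 1) i := by
  have hy : y k = y' k := by rw [h.y_eq, h'.y_eq, hx, hz]
  have hm := h.z_argmin k i hi
  have hm' := h'.z_argmin k i hi'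
  rw [← hy, ← hz] at hm'
  have hn : (0 : ℝ) < n := by exact_mod_cast i.pos
  have hτ : 0 < τ := by
    have := mul_pos h0 hn
    rwa [div_mul_cancel₀ _ hn.ne'] at this
  have hvi := hv i
  have hθ := theta_pos h0 k
  exact (hψ i).isMinOn_quad_unique (by positivity) hm hm' (h.mem_sepDom_z hψ k i)

/-- The iterates are determined by the sampled sets. -/
lemma congr (h : IsAPPROX f ψ v τ A x y z) (h' : IsAPPROX f ψ v τ A' x' y' z')
    (hψ : ∀ i, ClosedConvex (ψ i)) (hv : ∀ i, 0 < v i) (h0 : 0 < τ / n) (hx0 : x 0 = x' 0) :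
    ∀ {k : ℕ}, (∀ j < k, A j = A' j) → x k = x' k ∧ z k = z' k
  | 0, _ => ⟨hx0, by rw [h.init_z, h'.init_z, hx0]⟩
  | k + 1, hA => by
    obtain ⟨hx, hz⟩ := congr h h' hψ hv h0 hx0 fun j hj => hA j (hj.trans k.lt_succ_self)
    have hAk := hA k k.lt_succ_self
    have hz' : z (k + 1) = z' (k + 1) := by
      ext i
      by_cases hi : i ∈ A k
      · exact z_succ_congr h h' hψ hv h0 hx hz hi (hAk ▸ hi)
      · rw [h.z_stay k i hi, h'.z_stay k i (hAk ▸ hi), hz]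
    refine ⟨?_, hz'⟩
    rw [h.x_eq, h'.x_eq, h.y_eq, h'.y_eq, hx, hz, hz']

end IsAPPROX

/-- The potential function of the analysis of APPROX. -/
def potential (f : Vec n → ℝ) (ψ : Fin n → ℝ → EReal) (v : Fin n → ℝ) (xs : Vec n) (θ₀ : ℝ)
    (x z : ℕ → Vec n) (k : ℕ) : ℝ :=
  (1 - theta θ₀ k) / theta θ₀ k ^ 2 *
      (f (x k) + surrogate ψ θ₀ z k - (f xs + sepReal ψ xs))
    + 1 / (2 * θ₀ ^ 2) * wnormSq v (z k - xs)

lemma potential_congr {f : Vec n → ℝ} {ψ : Fin n → ℝ → EReal} {v : Fin n → ℝ} {xs : Vec n}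
    {θ₀ : ℝ} {x z x' z' : ℕ → Vec n} {k : ℕ} (hx : x k = x' k) (hz : ∀ j ≤ k, z j = z' j) :
    potential f ψ v xs θ₀ x z k = potential f ψ v xs θ₀ x' z' k := by
  rw [potential, potential, hx, surrogate_congr hz, hz k le_rfl]

/-- The potential does not increase in expectation over the set sampled at step `k`: the runs
indexed by `B` share the past of the reference run and sample `B` at step `k`. -/
lemma sum_potential_succ_le {f : Vec n → ℝ} {ψ : Fin n → ℝ → EReal} {v : Fin n → ℝ}
    (hd : Differentiable ℝ f) (hc : ConvexOn ℝ Set.univ f) (hψ : ∀ i, ClosedConvex (ψ i))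
    (hv : ∀ i, 0 < v i) {q : PMF (Finset (Fin n))} (hq : IsUniform q) (hESO : ESO f q v)
    (h0 : 0 < meanCard q / n) (h1 : meanCard q / n ≤ 1) {xs : Vec n} (hxs : xs ∈ sepDom ψ)
    {A : ℕ → Finset (Fin n)} {x y z : ℕ → Vec n} (h : IsAPPROX f ψ v (meanCard q) A x y z)
    {A' : Finset (Fin n) → ℕ → Finset (Fin n)} {x' y' z' : Finset (Fin n) → ℕ → Vec n}
    (h' : ∀ B, IsAPPROX f ψ v (meanCard q) (A' B) (x' B) (y' B) (z' B)) {k : ℕ}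
    (hA' : ∀ B, q B ≠ 0 → A' B k = B) (hx' : ∀ B, q B ≠ 0 → x' B k = x k)
    (hz' : ∀ B, q B ≠ 0 → ∀ j ≤ k, z' B j = z j) :
    ∑ B, (q B).toReal * potential f ψ v xs (meanCard q / n) (x' B) (z' B) (k + 1) ≤
      potential f ψ v xs (meanCard q / n) x z k := by
  set θ₀ := meanCard q / n with hθ₀
  have hθ := theta_pos h0 k
  have hθ1 : theta θ₀ k ≤ 1 := (theta_le_init h0 k).trans h1
  have hex : ∀ i : Fin n, ∃ B, i ∈ B ∧ q B ≠ 0 := fun i =>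
    exists_mem_of_inclProb_pos (by rw [hq.inclProb_eq]; exact h0)
  choose B hiB hqB using hex
  -- The full proximal step is assembled coordinatewise from runs that sample `i` with positive
  -- probability, so existence of minimizers is inherited from those runs.
  set zt : Vec n := WithLp.toLp 2 fun i => z' (B i) (k + 1) i with hzt
  have hmin : ∀ i, IsMinOn (fun t : ℝ =>
      ((gradient f (y k) i * (t - y k i)
          + theta θ₀ k * n * v i / (2 * meanCard q) * |t - z k i| ^ 2 : ℝ) : EReal)
        + ψ i t) Set.univ (zt i) := by
    intro i
    have hm := (h' (B i)).z_argmin k i (by rw [hA' _ (hqB i)]; exact hiB i)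
    rwa [(h' (B i)).y_eq, hx' _ (hqB i), hz' _ (hqB i) k le_rfl, ← h.y_eq] at hm
  set zp : Finset (Fin n) → Vec n := fun C =>
    WithLp.toLp 2 fun i => if i ∈ C then zt i else z k i with hzp
  have hz'p : ∀ C, q C ≠ 0 → z' C (k + 1) = zp C := by
    intro C hC
    ext i
    simp only [hzp]
    by_cases hi : i ∈ C
    · rw [if_pos hi]
      exact (h' C).z_succ_congr (h' (B i)) hψ hv h0 ((hx' C hC).trans (hx' _ (hqB i)).symm)
        ((hz' C hC k le_rfl).trans (hz' _ (hqB i) k le_rfl).symm)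
        (by rw [hA' C hC]; exact hi) (by rw [hA' _ (hqB i)]; exact hiB i)
    · rw [if_neg hi, (h' C).z_stay k i (by rw [hA' C hC]; exact hi), hz' C hC k le_rfl]
  have step := approx_step (ψ := ψ) (R := surrogate ψ θ₀ z k) (xs := xs) (zt := zt) (zp := zp)
    hd hc hq hESO hθ₀ h0 hθ hθ1 (h.y_eq k) (fun i => by
      have e : theta θ₀ k * n * v i / (2 * meanCard q) = theta θ₀ k * v i / (2 * θ₀) := by
        have hn : (n : ℝ) ≠ 0 := by exact_mod_cast i.pos.ne'
        rw [hθ₀]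
        field_simp
      have := ((hψ i).isMinOn_quad (hmin i) (h.mem_sepDom_z hψ k i)).2 (xs i) (hxs i)
      rwa [e] at this) fun C i => rfl
  have e1 : ∀ C, (q C).toReal * potential f ψ v xs θ₀ (x' C) (z' C) (k + 1) =
      (q C).toReal * ((f (y k + (theta θ₀ k / θ₀) • (zp C - z k))
        + ((1 - theta θ₀ k) * surrogate ψ θ₀ z k
          - theta θ₀ k * (1 / θ₀ - 1) * sepReal ψ (z k) + theta θ₀ k / θ₀ * sepReal ψ (zp C))
        - (f xs + sepReal ψ xs) + 1 / (2 * θ₀ ^ 2) * theta θ₀ k ^ 2 * wnormSq v (zp C - xs)))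
        / theta θ₀ k ^ 2 := by
    intro C
    by_cases hC : q C = 0
    · simp [hC]
    have ex : x' C (k + 1) = y k + (theta θ₀ k / θ₀) • (zp C - z k) := by
      rw [(h' C).x_eq, (h' C).y_eq, hx' C hC, hz'p C hC, hz' C hC k le_rfl, ← h.y_eq, ← hθ₀]
      congr 2
      rw [hθ₀, div_div_eq_mul_div]
      ring
    rw [potential, one_sub_theta_succ_div_sq h0, ex, surrogate, surrogate_congr (hz' C hC),
      hz'p C hC, hz' C hC k le_rfl]
    field_simp
  rw [Finset.sum_congr rfl fun C _ => e1 C, ← Finset.sum_div, potential]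
  have e2 : (1 - theta θ₀ k) / theta θ₀ k ^ 2 *
        (f (x k) + surrogate ψ θ₀ z k - (f xs + sepReal ψ xs))
        + 1 / (2 * θ₀ ^ 2) * wnormSq v (z k - xs) =
      ((1 - theta θ₀ k) * (f (x k) + surrogate ψ θ₀ z k - (f xs + sepReal ψ xs))
        + 1 / (2 * θ₀ ^ 2) * theta θ₀ k ^ 2 * wnormSq v (z k - xs)) / theta θ₀ k ^ 2 := by
    field_simp
  rw [e2]
  gcongr

/-! ### Expectations of functions of finitely valued random variables -/

section Finite

variable {Ω α β : Type*} [MeasurableSpace Ω] {P : Measure Ω} [IsProbabilityMeasure P]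
  [MeasurableSpace α] [MeasurableSingletonClass α] [MeasurableSpace β]
  [MeasurableSingletonClass β] {X : Ω → α} {Y : Ω → β}

/-- `G` is `X` followed by a function on a finite discrete space, so its measurability comes for
free. -/
lemma integrable_of_factorsThrough [Finite α] (hX : Measurable X) {G : Ω → ℝ}
    (hG : G.FactorsThrough X) : Integrable G P := by
  have : IsProbabilityMeasure (P.map X) := Measure.isProbabilityMeasure_map hX.aemeasurable
  have h : Integrable (Function.extend X G 0) (P.map X) := .of_finite
  have e : Function.extend X G 0 ∘ X = G := funext fun ω => hG.extend_apply 0 ω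
  exact e ▸ h.comp_measurable hX

lemma integral_comp_eq_sum [Fintype α] (hX : Measurable X) (g : α → ℝ) :
    ∫ ω, g (X ω) ∂P = ∑ a, P.real (X ⁻¹' {a}) * g a := by
  have : IsProbabilityMeasure (P.map X) := Measure.isProbabilityMeasure_map hX.aemeasurable
  rw [← integral_map hX.aemeasurable (f := g) .of_discrete, integral_fintype .of_finite]
  refine Finset.sum_congr rfl fun a _ => ?_
  rw [map_measureReal_apply hX (measurableSet_singleton a), smul_eq_mul]

/-- If `G` is a function of the independent variables `X` and `Y`, and its average over `Y` is at
most the function `G'` of `X`, then the same holds for the expectations. -/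
lemma integral_le_of_indepFun [Fintype α] [Fintype β] (hX : Measurable X) (hY : Measurable Y)
    (hXY : IndepFun X Y P) {G G' : Ω → ℝ} (hG' : G'.FactorsThrough X)
    (hG : G.FactorsThrough fun ω => (X ω, Y ω))
    (hle : ∀ (ω₀ : Ω) (ω : β → Ω),
      (∀ b, P (Y ⁻¹' {b}) ≠ 0 → X (ω b) = X ω₀ ∧ Y (ω b) = b) →
        ∑ b, P.real (Y ⁻¹' {b}) * G (ω b) ≤ G' ω₀) :
    ∫ ω, G ω ∂P ≤ ∫ ω, G' ω ∂P := by
  set g := Function.extend (fun ω => (X ω, Y ω)) G 0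
  set g' := Function.extend X G' 0
  have eg : ∀ ω, G ω = g (X ω, Y ω) := fun ω => (hG.extend_apply 0 ω).symm
  have eg' : ∀ ω, G' ω = g' (X ω) := fun ω => (hG'.extend_apply 0 ω).symm
  have hind : ∀ a b, P ((fun ω => (X ω, Y ω)) ⁻¹' {(a, b)}) =
      P (X ⁻¹' {a}) * P (Y ⁻¹' {b}) := fun a b => by
    rw [← hXY.measure_inter_preimage_eq_mul _ _ (measurableSet_singleton a)
      (measurableSet_singleton b)]
    congr 1
    ext ω
    simp
  simp only [eg, eg']
  rw [integral_comp_eq_sum (hX.prodMk hY), integral_comp_eq_sum hX, Fintype.sum_prod_type]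
  refine Finset.sum_le_sum fun a _ => ?_
  simp only [measureReal_def, hind, ENNReal.toReal_mul, mul_assoc, ← Finset.mul_sum]
  by_cases ha : P (X ⁻¹' {a}) = 0
  · simp [ha]
  refine mul_le_mul_of_nonneg_left ?_ ENNReal.toReal_nonneg
  obtain ⟨ω₀, hω₀⟩ : (X ⁻¹' {a}).Nonempty := nonempty_of_measure_ne_zero ha
  have hω : ∀ b, ∃ ω, P (Y ⁻¹' {b}) ≠ 0 → X ω = a ∧ Y ω = b := by
    intro b
    by_cases hb : P (Y ⁻¹' {b}) = 0
    · exact ⟨ω₀, fun h => absurd hb h⟩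
    · obtain ⟨ω, hω⟩ := nonempty_of_measure_ne_zero ((hind a b).trans_ne (mul_ne_zero ha hb))
      exact ⟨ω, fun _ => Prod.ext_iff.1 hω⟩
  choose ω hω using hω
  have hω₀' : X ω₀ = a := hω₀
  have h := hle ω₀ ω fun b hb => ⟨(hω b hb).1.trans hω₀'.symm, (hω b hb).2⟩
  rw [eg', hω₀'] at h
  refine le_trans (Finset.sum_congr rfl fun b _ => ?_).le h
  by_cases hb : P (Y ⁻¹' {b}) = 0
  · simp [hb, measureReal_def]
  · rw [eg, (hω b hb).1, (hω b hb).2, measureReal_def]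

end Finite

/-! ### Convergence of APPROX -/

/-- The sets sampled before step `k`. -/
def history {Ω : Type*} (S : ℕ → Ω → Finset (Fin n)) (k : ℕ) (ω : Ω) :
    Finset.range k → Finset (Fin n) := fun i => S i ω

lemma eq_of_history_eq {Ω : Type*} {S : ℕ → Ω → Finset (Fin n)} {k : ℕ} {ω ω' : Ω}
    (h : history S k ω = history S k ω') {j : ℕ} (hj : j < k) : S j ω = S j ω' :=
  congrFun h ⟨j, Finset.mem_range.2 hj⟩

lemma IsIIDSampling.measurable {Ω : Type*} [MeasurableSpace Ω] {P : Measure Ω}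
    {q : PMF (Finset (Fin n))} {S : ℕ → Ω → Finset (Fin n)} (hS : IsIIDSampling P q S) (k : ℕ) :
    Measurable[_, ⊤] (S k) :=
  @measurable_to_countable' _ _ ⊤ _ _ _ fun A => hS.measurableSet_eq k A

section Approx

variable {Ω : Type*} {q : PMF (Finset (Fin n))} {S : ℕ → Ω → Finset (Fin n)}
  {f : Vec n → ℝ} {ψ : Fin n → ℝ → EReal} {v : Fin n → ℝ} {x y z : ℕ → Ω → Vec n}
  {x₀ : Vec n}

lemma iterates_congr (hψ : ∀ i, ClosedConvex (ψ i)) (hv : ∀ i, 0 < v i)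
    (h0 : 0 < meanCard q / n) (hx₀ : ∀ ω, x 0 ω = x₀)
    (h : ∀ ω, IsAPPROX f ψ v (meanCard q)
      (fun k => S k ω) (fun k => x k ω) (fun k => y k ω) (fun k => z k ω))
    {k : ℕ} {ω ω' : Ω} (hh : history S k ω = history S k ω') {j : ℕ} (hj : j ≤ k) :
    x j ω = x j ω' ∧ z j ω = z j ω' :=
  (h ω).congr (h ω') hψ hv h0 ((hx₀ ω).trans (hx₀ ω').symm)
    fun _ hi => eq_of_history_eq hh (hi.trans_le hj)

variable [MeasurableSpace Ω] {P : Measure Ω} [IsProbabilityMeasure P]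

lemma integral_potential_succ_le (hd : Differentiable ℝ f) (hc : ConvexOn ℝ Set.univ f)
    (hψ : ∀ i, ClosedConvex (ψ i)) (hv : ∀ i, 0 < v i) (hq : IsUniform q) (hESO : ESO f q v)
    (h0 : 0 < meanCard q / n) (h1 : meanCard q / n ≤ 1) {xs : Vec n} (hxs : xs ∈ sepDom ψ)
    (hS : IsIIDSampling P q S) (hx₀ : ∀ ω, x 0 ω = x₀)
    (h : ∀ ω, IsAPPROX f ψ v (meanCard q)
      (fun k => S k ω) (fun k => x k ω) (fun k => y k ω) (fun k => z k ω)) (k : ℕ) :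
    ∫ ω, potential f ψ v xs (meanCard q / n) (fun k => x k ω) (fun k => z k ω) (k + 1) ∂P ≤
      ∫ ω, potential f ψ v xs (meanCard q / n) (fun k => x k ω) (fun k => z k ω) k ∂P := by
  let _ : MeasurableSpace (Finset (Fin n)) := ⊤
  have hm : ∀ k, Measurable (S k) := hS.measurable
  have hind : IndepFun (history S k) (S k) P := by
    have hi := iIndepFun.indepFun_finset (Finset.range k) {k} (by simp) hS.indep hm
    exact hi.comp (φ := id) (ψ := fun u : ({k} : Finset ℕ) → Finset (Fin n) =>
      u ⟨k, Finset.mem_singleton_self k⟩) measurable_id (measurable_pi_apply _)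
  have hX : Measurable (history S k) := measurable_pi_lambda _ fun i => hm i
  refine integral_le_of_indepFun hX (hm k) hind ?_ ?_ ?_
  · intro ω ω' hh
    exact potential_congr (iterates_congr hψ hv h0 hx₀ h hh le_rfl).1
      fun j hj => (iterates_congr hψ hv h0 hx₀ h hh hj).2
  · intro ω ω' hh
    -- The potential at `k + 1` depends on the draws before `k` together with the draw at `k`.
    have hh' : history S (k + 1) ω = history S (k + 1) ω' := by
      funext i
      rcases Nat.lt_succ_iff_lt_or_eq.1 (Finset.mem_range.1 i.2) with hi | hi
      · exact eq_of_history_eq (Prod.ext_iff.1 hh).1 hi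
      · have := (Prod.ext_iff.1 hh).2
        simp only [history, hi]
        exact this
    exact potential_congr (iterates_congr hψ hv h0 hx₀ h hh' le_rfl).1
      fun j hj => (iterates_congr hψ hv h0 hx₀ h hh' hj).2
  · intro ω₀ ω hω
    have hlaw : ∀ B, P (S k ⁻¹' {B}) = q B := hS.law k
    simp only [measureReal_def, hlaw] at hω ⊢
    exact sum_potential_succ_le hd hc hψ hv hq hESO h0 h1 hxs (h ω₀) (fun B => h (ω B))
      (fun B hB => (hω B hB).2)
      (fun B hB => (iterates_congr hψ hv h0 hx₀ h (hω B hB).1 le_rfl).1)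
      fun B hB j hj => (iterates_congr hψ hv h0 hx₀ h (hω B hB).1 hj).2

lemma integrable_of_congr_iterates (hψ : ∀ i, ClosedConvex (ψ i)) (hv : ∀ i, 0 < v i)
    (h0 : 0 < meanCard q / n) (hS : IsIIDSampling P q S) (hx₀ : ∀ ω, x 0 ω = x₀)
    (h : ∀ ω, IsAPPROX f ψ v (meanCard q)
      (fun k => S k ω) (fun k => x k ω) (fun k => y k ω) (fun k => z k ω)) {G : Ω → ℝ} (k : ℕ)
    (hG : ∀ ω ω', x k ω = x k ω' → (∀ j ≤ k, z j ω = z j ω') → G ω = G ω') :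
    Integrable G P := by
  let _ : MeasurableSpace (Finset (Fin n)) := ⊤
  have hm : ∀ k, Measurable (S k) := hS.measurable
  refine integrable_of_factorsThrough (X := history S k)
    (measurable_pi_lambda _ fun i => hm i) fun ω ω' hh => ?_
  exact hG ω ω' (iterates_congr hψ hv h0 hx₀ h hh le_rfl).1
    fun j hj => (iterates_congr hψ hv h0 hx₀ h hh hj).2

lemma approx_rate (hd : Differentiable ℝ f) (hc : ConvexOn ℝ Set.univ f)
    (hψ : ∀ i, ClosedConvex (ψ i)) (hv : ∀ i, 0 < v i) (hq : IsUniform q) (hESO : ESO f q v)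
    (h0 : 0 < meanCard q / n) (h1 : meanCard q / n ≤ 1) {xs : Vec n} (hxs : xs ∈ sepDom ψ)
    (hS : IsIIDSampling P q S) (hx₀ : ∀ ω, x 0 ω = x₀)
    (h : ∀ ω, IsAPPROX f ψ v (meanCard q)
      (fun k => S k ω) (fun k => x k ω) (fun k => y k ω) (fun k => z k ω)) (k : ℕ) :
    1 / theta (meanCard q / n) k ^ 2 * ∫ ω, gap (objective f ψ) xs (x (k + 1) ω) ∂P ≤
      (1 - meanCard q / n) / (meanCard q / n) ^ 2 * gap (objective f ψ) xs x₀
        + 1 / (2 * (meanCard q / n) ^ 2) * wnormSq v (x₀ - xs) := by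
  set θ₀ := meanCard q / n with hθ₀
  have hmono : ∀ k,
      ∫ ω, potential f ψ v xs θ₀ (fun k => x k ω) (fun k => z k ω) k ∂P ≤
        ∫ ω, potential f ψ v xs θ₀ (fun k => x k ω) (fun k => z k ω) 0 ∂P := by
    intro k
    induction k with
    | zero => rfl
    | succ k ih =>
      exact (integral_potential_succ_le hd hc hψ hv hq hESO h0 h1 hxs hS hx₀ h k).trans ih
  have hzero : ∀ ω, potential f ψ v xs θ₀ (fun k => x k ω) (fun k => z k ω) 0 =
      (1 - θ₀) / θ₀ ^ 2 * gap (objective f ψ) xs x₀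
        + 1 / (2 * θ₀ ^ 2) * wnormSq v (x₀ - xs) := by
    intro ω
    have hz0 : z 0 ω = x₀ := (h ω).init_z.trans (hx₀ ω)
    have hd0 : x₀ ∈ sepDom ψ := hz0 ▸ (h ω).mem_sepDom_z hψ 0
    rw [gap_eq hψ hxs hd0]
    simp only [potential, surrogate, theta, hz0, hx₀ ω]
  have hlast := hmono (k + 1)
  simp only [hzero, integral_const, probReal_univ, one_smul] at hlast
  refine le_trans ?_ hlast
  rw [← integral_const_mul]
  refine integral_mono ?_ ?_ fun ω => ?_
  · exact (integrable_of_congr_iterates hψ hv h0 hS hx₀ h (k + 1)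
      fun ω ω' hx _ => by rw [hx]).const_mul _
  · exact integrable_of_congr_iterates hψ hv h0 hS hx₀ h (k + 1)
      fun ω ω' hx hz => potential_congr hx hz
  -- The gap is recovered from the potential by replacing the surrogate with `ψ(x_{k+1})` and
  -- dropping the nonnegative distance.
  · obtain ⟨hxd, hsur⟩ := (h ω).sepReal_le_surrogate hψ h0 h1 (k + 1)
    simp only [potential]
    rw [one_sub_theta_succ_div_sq h0, gap_eq hψ hxs hxd]
    have hw := mul_nonneg (show 0 ≤ 1 / (2 * θ₀ ^ 2) by positivity)
      (wnormSq_nonneg hv (z (k + 1) ω - xs))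
    have hθ : 0 ≤ 1 / theta θ₀ k ^ 2 := by positivity
    have := mul_le_mul_of_nonneg_left
      (show f (x (k + 1) ω) + sepReal ψ (x (k + 1) ω) - (f xs + sepReal ψ xs) ≤
        f (x (k + 1) ω) + surrogate ψ θ₀ (fun k => z k ω) (k + 1)
          - (f xs + sepReal ψ xs) by linarith) hθ
    linarith

end Approx

lemma gap_nonneg {f : Vec n → ℝ} {ψ : Fin n → ℝ → EReal} (hψ : ∀ i, ClosedConvex (ψ i))
    {xs x : Vec n} (hxs : ∀ x, objective f ψ xs ≤ objective f ψ x) (hx : x ∈ sepDom ψ) :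
    xs ∈ sepDom ψ ∧ 0 ≤ gap (objective f ψ) xs x := by
  have hs : xs ∈ sepDom ψ := mem_sepDom_of_objective_ne_top hψ
    ((hxs x).trans_lt (by rw [objective_eq_coe hψ hx]; exact EReal.coe_lt_top _)).ne
  have h := hxs x
  rw [objective_eq_coe hψ hs, objective_eq_coe hψ hx, EReal.coe_le_coe_iff] at h
  refine ⟨hs, ?_⟩
  rw [gap_eq hψ hs hx]
  linarith

lemma wnormSq_le_gap {f : Vec n → ℝ} {ψ : Fin n → ℝ → EReal} (hψ : ∀ i, ClosedConvex (ψ i))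
    {v : Fin n → ℝ} {μ : ℝ} {xs x : Vec n} (hs : xs ∈ sepDom ψ) (hx : x ∈ sepDom ψ)
    (hg : objective f ψ xs + ((μ / 2 * wnormSq v (x - xs) : ℝ) : EReal) ≤ objective f ψ x) :
    μ / 2 * wnormSq v (x - xs) ≤ gap (objective f ψ) xs x := by
  rw [objective_eq_coe hψ hs, objective_eq_coe hψ hx, ← EReal.coe_add,
    EReal.coe_le_coe_iff] at hg
  rw [gap_eq hψ hs hx]
  linarith

end AccGrad

end

theorem mainTheorem6 {n : ℕ} (f : AccGrad.Vec n → ℝ) (ψ : Fin n → ℝ → EReal)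
    (v : Fin n → ℝ) (xs : AccGrad.Vec n) (μ : ℝ)
    (hf_diff : Differentiable ℝ f) (hf_conv : ConvexOn ℝ Set.univ f)
    (hψ : ∀ i, AccGrad.ClosedConvex (ψ i))
    (hv : ∀ i, 0 < v i)
    (hxs : ∀ x, AccGrad.objective f ψ xs ≤ AccGrad.objective f ψ x)
    (hμ : 0 < μ)
    (hgrowth : ∀ x, AccGrad.objective f ψ xs
        + ((μ / 2 * AccGrad.wnormSq v (x - xs) : ℝ) : EReal) ≤ AccGrad.objective f ψ x) :
    -- FISTA, a deterministic algorithm with `θ₀ = 1`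
    (AccGrad.QuadUpperBound f v →
      ∀ x y z : ℕ → AccGrad.Vec n, AccGrad.IsFISTA f ψ v x y z →
      ∀ θ₀ : ℝ, θ₀ = 1 →
        (∀ k, AccGrad.objective f ψ (x k) ≠ ⊤) ∧
        (∀ k : ℕ, 1 ≤ k →
          AccGrad.gap (AccGrad.objective f ψ) xs (x k) ≤
            AccGrad.theta θ₀ (k - 1) ^ 2 * ((1 - θ₀) / θ₀ ^ 2 + 1 / (μ * θ₀ ^ 2))
              * AccGrad.gap (AccGrad.objective f ψ) xs (x 0)) ∧
        (∀ α : ℝ, 0 < α → α < 1 → ∀ k : ℕ,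
          2 / θ₀ * (Real.sqrt ((1 + μ) / (α * μ)) - 1) + 1 ≤ (k : ℝ) →
          AccGrad.gap (AccGrad.objective f ψ) xs (x k) ≤
            α * AccGrad.gap (AccGrad.objective f ψ) xs (x 0))) ∧
    -- APPROX, started at the deterministic point `x₀`, with `θ₀ = τ / n`
    (∀ q : PMF (Finset (Fin n)), AccGrad.IsUniform q → 0 < AccGrad.meanCard q →
      AccGrad.ESO f q v →
      ∀ (Ω : Type*) [MeasurableSpace Ω] (P : Measure Ω) [IsProbabilityMeasure P]
        (S : ℕ → Ω → Finset (Fin n)), AccGrad.IsIIDSampling P q S →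
      ∀ (x₀ : AccGrad.Vec n) (x y z : ℕ → Ω → AccGrad.Vec n), (∀ ω, x 0 ω = x₀) →
        (∀ ω, AccGrad.IsAPPROX f ψ v (AccGrad.meanCard q)
          (fun k => S k ω) (fun k => x k ω) (fun k => y k ω) (fun k => z k ω)) →
      ∀ θ₀ : ℝ, θ₀ = AccGrad.meanCard q / n →
        (∀ k ω, AccGrad.objective f ψ (x k ω) ≠ ⊤) ∧
        (∀ k, Integrable (fun ω => AccGrad.gap (AccGrad.objective f ψ) xs (x k ω)) P) ∧
        (∀ k : ℕ, 1 ≤ k →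
          ∫ ω, AccGrad.gap (AccGrad.objective f ψ) xs (x k ω) ∂P ≤
            AccGrad.theta θ₀ (k - 1) ^ 2 * ((1 - θ₀) / θ₀ ^ 2 + 1 / (μ * θ₀ ^ 2))
              * AccGrad.gap (AccGrad.objective f ψ) xs x₀) ∧
        (∀ α : ℝ, 0 < α → α < 1 → ∀ k : ℕ,
          2 / θ₀ * (Real.sqrt ((1 + μ) / (α * μ)) - 1) + 1 ≤ (k : ℝ) →
          ∫ ω, AccGrad.gap (AccGrad.objective f ψ) xs (x k ω) ∂P ≤
            α * AccGrad.gap (AccGrad.objective f ψ) xs x₀)) := by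
  refine ⟨fun hub x y z h θ₀ hθ₀ => ?_, fun q hq hτ hESO Ω _ P _ S hS x₀ x y z hx₀ h θ₀ hθ₀ => ?_⟩
  · subst hθ₀
    have hx0 : x 0 ∈ AccGrad.sepDom ψ := (AccGrad.mem_sepDom_iff hψ).2 h.init_mem_dom
    obtain ⟨hs, hg0⟩ := AccGrad.gap_nonneg hψ hxs hx0
    obtain ⟨hdom, hrate⟩ := h.rate hf_diff hf_conv hψ hub hv hs
    have hmain : ∀ k : ℕ, 1 ≤ k → AccGrad.gap (AccGrad.objective f ψ) xs (x k) ≤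
        AccGrad.theta 1 (k - 1) ^ 2 * ((1 - 1) / 1 ^ 2 + 1 / (μ * 1 ^ 2))
          * AccGrad.gap (AccGrad.objective f ψ) xs (x 0) := by
      intro k hk
      obtain ⟨k, rfl⟩ := Nat.exists_eq_add_of_le' hk
      refine AccGrad.rate_of_potential_le one_pos (AccGrad.theta_pos one_pos _) hμ
        (AccGrad.wnormSq_le_gap hψ hs hx0 (hgrowth (x 0))) ?_
      rw [AccGrad.gap_eq hψ hs (hdom _)]
      simpa using hrate k
    refine ⟨fun k => ?_, hmain, fun α hα hα1 k hk => ?_⟩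
    · rw [AccGrad.objective_eq_coe hψ (hdom k)]
      exact EReal.coe_ne_top _
    · obtain ⟨hk1, hle⟩ := AccGrad.theta_sq_mul_le one_pos hμ hα hα1 hk
      exact (hmain k hk1).trans (mul_le_mul_of_nonneg_right hle hg0)
  · subst hθ₀
    have hn : (0 : ℝ) < n := hτ.trans_le (AccGrad.meanCard_le q)
    have h0 : 0 < AccGrad.meanCard q / n := div_pos hτ hn
    have h1 : AccGrad.meanCard q / n ≤ 1 := (div_le_one hn).2 (AccGrad.meanCard_le q)
    -- Finiteness of `ψ(x₀)` is stated along runs, so one outcome is needed to read it off.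
    obtain ⟨ω⟩ : Nonempty Ω := nonempty_of_isProbabilityMeasure P
    have hx0 : x₀ ∈ AccGrad.sepDom ψ := by
      rw [← hx₀ ω]
      exact (AccGrad.mem_sepDom_iff hψ).2 (h ω).init_mem_dom
    obtain ⟨hs, hg0⟩ := AccGrad.gap_nonneg hψ hxs hx0
    have hmain : ∀ k : ℕ, 1 ≤ k → ∫ ω, AccGrad.gap (AccGrad.objective f ψ) xs (x k ω) ∂P ≤
        AccGrad.theta (AccGrad.meanCard q / n) (k - 1) ^ 2 *
          ((1 - AccGrad.meanCard q / n) / (AccGrad.meanCard q / n) ^ 2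
            + 1 / (μ * (AccGrad.meanCard q / n) ^ 2))
          * AccGrad.gap (AccGrad.objective f ψ) xs x₀ := by
      intro k hk
      obtain ⟨k, rfl⟩ := Nat.exists_eq_add_of_le' hk
      exact AccGrad.rate_of_potential_le h0 (AccGrad.theta_pos h0 _) hμ
        (AccGrad.wnormSq_le_gap hψ hs hx0 (hgrowth x₀))
        (AccGrad.approx_rate hf_diff hf_conv hψ hv hq hESO h0 h1 hs hS hx₀ h k)
    refine ⟨fun k ω => ?_, fun k => ?_, hmain, fun α hα hα1 k hk => ?_⟩
    · rw [AccGrad.objective_eq_coe hψ ((h ω).sepReal_le_surrogate hψ h0 h1 k).1]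
      exact EReal.coe_ne_top _
    · exact AccGrad.integrable_of_congr_iterates hψ hv h0 hS hx₀ h k
        fun ω ω' hx _ => by rw [hx]
    · obtain ⟨hk1, hle⟩ := AccGrad.theta_sq_mul_le h0 hμ hα hα1 hk
      exact (hmain k hk1).trans (mul_le_mul_of_nonneg_right hle hg0)
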